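/- Let $k\ge 1$. A linear $k$-chord diagram of length $kn$ is a partition of $kn$ linearly ordered vertices into $n$ blocks of size $k$, called $k$-chords. A $k$-chord is short if it consists of $k$ consecutive vertices. Two short chords are adjacent if the last vertex of one immediately precedes the first vertex of the other, and a connected component is a (nonempty) maximal set of successively adjacent short chords. For $n,q\ge 0$ let $c_{n,q}$ be the number of linear $k$-chord diagrams of length $kn$ with exactly $q$ connected components. Then $c_{n,q}=[y^nz^q]\,C_k(y,z)$ for all $n,q\ge 0$, where $C_k$ is the formal power series $$C_k(y,z)=\sum_{j\ge 0}\frac{(kj)!}{j!\,(k!)^j}\,y^j\left(\frac{1-y(1-z)}{1-y^2(1-z)}\right)^{kj+1}.$$ -/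

import Mathlib

/-- A linear `k`-chord diagram of length `k * n`: a partition of the linearly ordered vertices
`0, 1, …, k * n - 1` into blocks (the `k`-chords), each consisting of exactly `k` vertices. -/
structure LinearChordDiagram (k n : ℕ) where
  /-- The underlying set partition of the vertices. -/
  toPartition : Finpartition (Finset.univ : Finset (Fin (k * n)))
  /-- Every block has exactly `k` vertices. -/
  card_chord : ∀ s ∈ toPartition.parts, s.card = k

namespace LinearChordDiagram

variable {k n : ℕ}

/-- The set of `k`-chords of a diagram. -/
def chords (D : LinearChordDiagram k n) : Finset (Finset (Fin (k * n))) :=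
  D.toPartition.parts

/-- A `k`-chord is short if it is formed on a set of `k` adjacent vertices
`a, a + 1, …, a + k - 1`. -/
def IsShort (s : Finset (Fin (k * n))) : Prop :=
  ∃ a : ℕ, s.map Fin.valEmbedding = Finset.Ico a (a + k)

/-- The type of short chords of a diagram. -/
def ShortChord (D : LinearChordDiagram k n) : Type :=
  {s : Finset (Fin (k * n)) // s ∈ D.chords ∧ IsShort s}

/-- The adjacency graph on the short chords of a diagram: two distinct short chords are adjacent
if some vertex of one immediately precedes or follows a vertex of the other on the line. -/
def shortChordGraph (D : LinearChordDiagram k n) : SimpleGraph D.ShortChord where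
  Adj s t := s ≠ t ∧ ∃ i ∈ s.1, ∃ j ∈ t.1, (i : ℕ) + 1 = j ∨ (j : ℕ) + 1 = i
  symm := ⟨fun _ _ ⟨h, i, hi, j, hj, hij⟩ => ⟨h.symm, j, hj, i, hi, hij.symm⟩⟩
  loopless := ⟨fun _ h => h.1 rfl⟩

/-- The number of connected components of short chords of a diagram, that is, of maximal runs of
successively adjacent short chords. -/
noncomputable def numComponents (D : LinearChordDiagram k n) : ℕ :=
  Nat.card D.shortChordGraph.ConnectedComponent

end LinearChordDiagram

/-- The number `c_{n,q}` of linear `k`-chord diagrams of length `k * n` with exactly `q` connected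
components of short chords. -/
noncomputable def componentCount (k n q : ℕ) : ℕ :=
  Nat.card {D : LinearChordDiagram k n // D.numComponents = q}

/-- The family `f 0, f 1, …` of formal power series is summable in the formal sense (every
coefficient is nonzero in only finitely many of them), and its sum is `g`. -/
def HasFormalSum {σ R : Type*} [CommRing R] (f : ℕ → MvPowerSeries σ R)
    (g : MvPowerSeries σ R) : Prop :=
  ∀ d : σ →₀ ℕ, {j | MvPowerSeries.coeff d (f j) ≠ 0}.Finite ∧
    ∑ᶠ j, MvPowerSeries.coeff d (f j) = MvPowerSeries.coeff d g

/-- The formal variable `y`, marking `n`. -/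
noncomputable def yVar : MvPowerSeries (Fin 2) ℚ := MvPowerSeries.X 0

/-- The formal variable `z`, marking the number of connected components. -/
noncomputable def zVar : MvPowerSeries (Fin 2) ℚ := MvPowerSeries.X 1

/-- The `j`-th term `(kj)! / (j! (k!)^j) * y^j * ((1 - y(1-z)) / (1 - y²(1-z)))^(kj+1)`. The
inverse is a genuine one, as `1 - y²(1-z)` has constant coefficient `1`. -/
noncomputable def componentTerm (k j : ℕ) : MvPowerSeries (Fin 2) ℚ :=
  MvPowerSeries.C (((k * j).factorial : ℚ) / ((j.factorial : ℚ) * (k.factorial : ℚ) ^ j)) *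
    yVar ^ j *
    ((1 - yVar * (1 - zVar)) * (1 - yVar ^ 2 * (1 - zVar))⁻¹) ^ (k * j + 1)

/-!
Label the `n` chords of a diagram. Reading the labels along the line turns the labelled diagrams of
length `k * n` into the words in `n` letters in which each letter occurs `k` times, and every diagram
comes from `n!` of these (`LinearChordDiagram.runSum_eq_factorial_mul`). A short chord becomes a
block of `k` equal letters, and a component becomes a run of consecutive blocks, which is counted at
its first block (`LinearChordDiagram.numComponents_eq_card`, `numRuns`).

To count words by runs, let `H₀` and `H₁` be the generating functions, with a variable `x_a` for each
letter `a` and with `z` marking runs, of the words that are not, respectively are, read as preceded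
by a block. Reading off one letter, and correcting for the words that begin with a block, gives
`H₀ = 1 + S H₀ + T (z H₁ - H₀)` and `H₁ = 1 + S H₀ + T (H₁ - H₀)` with `S = ∑ x_a` and
`T = ∑ x_a ^ k`, valid at all monomials with exponents at most `k` (`runSum_eq`). Such a system has
only one solution, and with `R(y) = (1 - y(1 - z)) / (1 - y²(1 - z))` it is
`H₀ = ∑ S^i R(T)^(i + 1)` and `H₁ = H₀ / (1 - (1 - z) T)` (`runSum_eq_coeff_psumSeries`). The
coefficient of `∏ x_a ^ k` in `S^(k j) T^(n - j)` is `n! (k j)! / (j! (k!)^j)`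
(`coeff_psum_pow_mul_indicator`), and dividing by `n!` leaves the coefficient of `y^n` in the series
of the theorem.

The series in the `x_a` are replaced by polynomials truncated at a degree larger than that of the
monomials in question. Powers of `R` enter through their coefficients of `y^m`, which are power
series in `z`; all that matters about them is two recurrences.
-/

open Finset
open scoped Classical

/-! ### Runs of blocks in words -/

/-- The position `p` of the word `l` is the start of a `k`-block: the word reads `k` equal letters
from there on. -/
def IsBlockAt {σ : Type*} (k : ℕ) (l : List σ) (p : ℕ) : Prop :=
  ∃ a, List.replicate k a <+: l.drop p

/-- The number of runs of consecutive `k`-blocks of the word `l`, a run being counted at its first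
block: the start of a `k`-block that is not itself preceded by a `k`-block. The flag `b` tells
whether `l` is to be read as preceded by a `k`-block, in which case a run at the very start of `l`
continues an earlier run and is not counted. -/
noncomputable def numRuns {σ : Type*} (k : ℕ) (b : Bool) (l : List σ) : ℕ :=
  #{p ∈ range l.length | IsBlockAt k l p ∧ ¬(k ≤ p ∧ IsBlockAt k l (p - k)) ∧ ¬(b = true ∧ p = 0)}

section Words

variable {σ : Type*} {k : ℕ}

lemma isBlockAt_cons_succ (a : σ) (l : List σ) (p : ℕ) :
    IsBlockAt k (a :: l) (p + 1) ↔ IsBlockAt k l p := by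
  simp [IsBlockAt]

lemma isBlockAt_append_add (u l : List σ) (p : ℕ) :
    IsBlockAt k (u ++ l) (u.length + p) ↔ IsBlockAt k l p := by
  simp [IsBlockAt, List.drop_append, List.drop_eq_nil_of_le]

lemma numRuns_cons_of_not_isBlockAt (hk : 1 ≤ k) (b : Bool) {a : σ} {l : List σ}
    (h : ¬ IsBlockAt k (a :: l) 0) : numRuns k b (a :: l) = numRuns k false l := by
  unfold numRuns
  simp only [card_filter, List.length_cons]
  rw [sum_range_succ']
  simp only [h, false_and, if_false, add_zero]
  refine sum_congr rfl fun p _ => ?_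
  congr 1
  simp only [isBlockAt_cons_succ, Nat.add_eq_zero_iff, one_ne_zero, and_false, not_false_eq_true,
    and_true, Bool.false_eq_true, false_and, eq_iff_iff]
  refine and_congr_right fun _ => not_congr ?_
  rcases lt_trichotomy k (p + 1) with hlt | heq | hgt
  · obtain ⟨r, rfl⟩ : ∃ r, p = k + r := ⟨p - k, by omega⟩
    rw [show k + r + 1 - k = r + 1 by omega, isBlockAt_cons_succ]
    simp; omega
  · subst heq
    simp [h]
  · constructor <;> (intro h'; omega)

lemma not_isBlockAt_replicate_append {a : σ} {l : List σ} (ha : a ∉ l) {m p : ℕ} (hp : p < m)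
    (hm : m < p + k) : ¬ IsBlockAt k (List.replicate m a ++ l) p := by
  rintro ⟨c, u, hu⟩
  obtain ⟨r, rfl⟩ : ∃ r, m = p + (r + 1) := ⟨m - p - 1, by omega⟩
  have hd : (List.replicate (p + (r + 1)) a ++ l).drop p = List.replicate (r + 1) a ++ l := by
    rw [List.replicate_add, List.append_assoc, List.drop_left' (by simp)]
  rw [hd] at hu
  obtain ⟨s, rfl⟩ : ∃ s, k = (r + 1) + (s + 1) := ⟨k - (r + 1) - 1, by omega⟩
  rw [List.replicate_add, List.append_assoc] at hu
  obtain ⟨h1, h2⟩ := List.append_inj hu (by simp)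
  have hca : c = a := by
    simpa using h1
  subst hca
  apply ha
  rw [← h2]
  simp

lemma numRuns_replicate_append_of_lt {a : σ} {l : List σ} (ha : a ∉ l) {m : ℕ} (hm : m < k) :
    numRuns k false (List.replicate m a ++ l) = numRuns k false l := by
  induction m with
  | zero => simp
  | succ m ih =>
    rw [← ih (by omega), List.replicate_succ, List.cons_append]
    apply numRuns_cons_of_not_isBlockAt (by omega)
    exact not_isBlockAt_replicate_append (m := m + 1) ha (by omega) (by omega)

/-- An initial block starts a run unless the word is read as preceded by a block, and what follows
is then read as preceded by a block. -/
lemma numRuns_replicate_append (hk : 1 ≤ k) (b : Bool) {a : σ} {l : List σ} (ha : a ∉ l) :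
    numRuns k b (List.replicate k a ++ l) = (if b then 0 else 1) + numRuns k true l := by
  unfold numRuns
  simp only [card_filter, List.length_append, List.length_replicate]
  have hshift : ∀ p, IsBlockAt k (List.replicate k a ++ l) (k + p) ↔ IsBlockAt k l p := fun p => by
    simpa using isBlockAt_append_add (k := k) (List.replicate k a) l p
  have h0 : IsBlockAt k (List.replicate k a ++ l) 0 := ⟨a, by simp⟩
  rw [sum_range_add]
  congr 1
  · obtain ⟨m, rfl⟩ : ∃ m, k = m + 1 := ⟨k - 1, by omega⟩
    rw [sum_range_succ', sum_eq_zero]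
    · cases b <;> simp [h0]
    · intro p hp
      rw [mem_range] at hp
      rw [if_neg]
      exact fun h => not_isBlockAt_replicate_append ha (by omega) (by omega) h.1
  · refine sum_congr rfl fun p _ => ?_
    congr 1
    rw [hshift, Nat.add_sub_cancel_left]
    simp only [eq_iff_iff, le_add_iff_nonneg_right, zero_le, true_and]
    refine and_congr_right fun _ => ?_
    have hkp : ¬ (b = true ∧ k + p = 0) := by omega
    simp only [hkp, not_false_eq_true, and_true]
    rcases Nat.eq_zero_or_pos p with rfl | hp
    · simp [h0]
    · rcases lt_or_ge p k with hlt | hge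
      · simp [not_isBlockAt_replicate_append (k := k) ha hlt (by omega), hlt.not_ge, hp.ne']
      · obtain ⟨r, rfl⟩ : ∃ r, p = k + r := ⟨p - k, by omega⟩
        rw [hshift]
        simp; omega

/-- The words in which each letter `a` occurs exactly `c a` times. -/
noncomputable def words (c : σ →₀ ℕ) : Finset (List σ) := (Finsupp.toMultiset c).lists.toFinset

lemma mem_words {c : σ →₀ ℕ} {l : List σ} : l ∈ words c ↔ ∀ a, l.count a = c a := by
  rw [words, Multiset.mem_toFinset, Multiset.mem_lists_iff]
  simp only [Multiset.ext, Finsupp.count_toMultiset, Multiset.quot_mk_to_coe, Multiset.coe_count]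
  exact forall_congr' fun a => eq_comm

lemma words_zero : words (0 : σ →₀ ℕ) = {[]} := by
  ext l
  rw [mem_words, mem_singleton]
  constructor
  · intro h
    refine List.eq_nil_iff_forall_not_mem.2 fun a ha => ?_
    have := h a
    rw [Finsupp.zero_apply, List.count_eq_zero] at this
    exact this ha
  · rintro rfl; simp

lemma replicate_append_mem_words {c : σ →₀ ℕ} {m : ℕ} {a : σ} {l : List σ} :
    List.replicate m a ++ l ∈ words c ↔ Finsupp.single a m ≤ c ∧ l ∈ words (c - .single a m) := by
  simp only [mem_words, List.count_append, List.count_replicate, Finsupp.single_le_iff,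
    Finsupp.tsub_apply, Finsupp.single_apply]
  constructor
  · intro h
    refine ⟨by have := h a; simp at this; omega, fun x => ?_⟩
    have := h x
    by_cases hx : a = x <;> simp [hx] at this ⊢ <;> omega
  · rintro ⟨h1, h2⟩ x
    have := h2 x
    by_cases hx : a = x
    · subst hx; simp at this ⊢; omega
    · simp [hx] at this ⊢; omega

/-- Summing over the words that begin with an `m`-block, by the letter of that block and what
follows it. -/
lemma sum_words_isBlockAt_zero [Fintype σ] {R : Type*} [AddCommMonoid R] {m : ℕ} (hm : 1 ≤ m)
    (c : σ →₀ ℕ) (g : List σ → R) :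
    ∑ l ∈ words c with IsBlockAt m l 0, g l =
      ∑ a, if Finsupp.single a m ≤ c then
        ∑ l ∈ words (c - .single a m), g (List.replicate m a ++ l) else 0 := by
  have hset : ({l ∈ words c | IsBlockAt m l 0} : Finset (List σ)) =
      univ.biUnion fun a => ({l ∈ words c | List.replicate m a <+: l} : Finset (List σ)) := by
    ext l
    simp [IsBlockAt]
  rw [hset, sum_biUnion]
  · refine sum_congr rfl fun a _ => ?_
    split_ifs with h
    · refine (sum_bij (fun l _ => List.replicate m a ++ l) ?_ ?_ ?_ ?_).symm
      · intro l hl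
        rw [mem_filter]
        exact ⟨replicate_append_mem_words.2 ⟨h, hl⟩, List.prefix_append _ _⟩
      · intro l _ l' _ hll
        exact List.append_cancel_left hll
      · intro l hl
        rw [mem_filter] at hl
        obtain ⟨h1, u, rfl⟩ := hl
        exact ⟨u, (replicate_append_mem_words.1 h1).2, rfl⟩
      · intro l _; rfl
    · rw [sum_eq_zero]
      intro l hl
      rw [mem_filter] at hl
      obtain ⟨h1, u, rfl⟩ := hl
      exact absurd (replicate_append_mem_words.1 h1).1 h
  · intro a _ a' _ haa
    rw [Function.onFun, disjoint_left]
    intro l hl hl'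
    rw [mem_filter] at hl hl'
    obtain ⟨u, hu⟩ := hl.2
    obtain ⟨u', hu'⟩ := hl'.2
    have := (List.append_inj (hu.trans hu'.symm) (by simp)).1
    apply haa
    obtain ⟨r, rfl⟩ : ∃ r, m = r + 1 := ⟨m - 1, by omega⟩
    simpa using this

/-- The run enumerator of the words with content `c`. -/
noncomputable def runSum {R : Type*} [CommRing R] (k : ℕ) (z : R) (b : Bool) (c : σ →₀ ℕ) : R :=
  ∑ l ∈ words c, z ^ numRuns k b l

lemma runSum_zero {R : Type*} [CommRing R] (z : R) (b : Bool) :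
    runSum k z b (0 : σ →₀ ℕ) = 1 := by
  simp [runSum, words_zero, numRuns]

/-- Reading off the first letter, and correcting for the words that begin with a `k`-block. The
content is bounded by `k`, so that a block exhausts its letter: what follows an initial `k`-block
of `a` has no `a`, and removing only the first letter of the block destroys it. -/
lemma runSum_eq [Fintype σ] {R : Type*} [CommRing R] (hk : 1 ≤ k) (z : R) (b : Bool)
    {c : σ →₀ ℕ} (hc : ∀ a, c a ≤ k) (hc0 : c ≠ 0) :
    runSum k z b c =
      (∑ a, if Finsupp.single a 1 ≤ c then runSum k z false (c - .single a 1) else 0) +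
      ∑ a, if Finsupp.single a k ≤ c then
        (if b then 1 else z) * runSum k z true (c - .single a k) -
          runSum k z false (c - .single a k) else 0 := by
  have key : ∀ l ∈ words c, z ^ numRuns k b l = z ^ numRuns k false l.tail +
      if IsBlockAt k l 0 then (if b then 1 else z) * z ^ numRuns k true (l.drop k) -
        z ^ numRuns k false (l.drop k) else 0 := by
    intro l hl
    split_ifs with h hb
    all_goals try
      obtain ⟨a, u, hu⟩ := h
      rw [List.drop_zero] at hu
      subst hu
      have hau : a ∉ u := by
        have := mem_words.1 hl a
        have hca := hc a
        rw [List.count_append, List.count_replicate_self] at this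
        exact List.count_eq_zero.1 (by omega)
      have htail : (List.replicate k a ++ u).tail = List.replicate (k - 1) a ++ u := by
        obtain ⟨r, rfl⟩ : ∃ r, k = r + 1 := ⟨k - 1, by omega⟩
        simp [List.replicate_succ]
      rw [htail, numRuns_replicate_append hk b hau,
        numRuns_replicate_append_of_lt hau (by omega), List.drop_left' (by simp)]
    · simp [hb]
    · simp [hb, pow_add]
    · rcases l with _ | ⟨a, u⟩
      · exfalso
        apply hc0
        ext a
        simpa using (mem_words.1 hl a).symm
      · rw [numRuns_cons_of_not_isBlockAt hk b h, List.tail_cons, add_zero]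
  rw [runSum, sum_congr rfl key, sum_add_distrib, ← sum_filter,
    sum_words_isBlockAt_zero hk]
  congr 1
  · have hall : words c = ({l ∈ words c | IsBlockAt 1 l 0} : Finset (List σ)) := by
      refine (filter_true_of_mem fun l hl => ?_).symm
      rcases l with _ | ⟨a, u⟩
      · exfalso
        apply hc0
        ext a
        simpa using (mem_words.1 hl a).symm
      · exact ⟨a, u, by simp⟩
    rw [hall, sum_words_isBlockAt_zero le_rfl]
    simp [runSum]
  · refine sum_congr rfl fun a _ => ?_
    split_ifs <;> simp [runSum, mul_sum, sum_sub_distrib]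

end Words

/-! ### The run enumerators as truncated power series -/

section TruncatedSeries

open MvPolynomial

variable {σ R : Type*} [Fintype σ] [CommRing R]

lemma coeff_psum_mul (m : ℕ) (c : σ →₀ ℕ) (p : MvPolynomial σ R) :
    coeff c (psum σ R m * p) =
      ∑ a, if Finsupp.single a m ≤ c then coeff (c - .single a m) p else 0 := by
  simp only [psum, sum_mul, coeff_sum, X_pow_eq_monomial, coeff_monomial_mul', one_mul]

lemma isHomogeneous_psum (m : ℕ) : (psum σ R m).IsHomogeneous m :=
  IsHomogeneous.sum _ _ _ fun i _ => by simpa using (isHomogeneous_X R i).pow m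

lemma coeff_psum_pow_mul_eq_zero (k : ℕ) {i m : ℕ} {c : σ →₀ ℕ} (h : c.degree ≠ i + k * m) :
    coeff c (psum σ R 1 ^ i * psum σ R k ^ m) = 0 := by
  have := ((isHomogeneous_psum (σ := σ) (R := R) 1).pow i).mul ((isHomogeneous_psum k).pow m)
  exact this.coeff_eq_zero (by simpa using h)

/-- The truncation to `i, m < N` of the double series `∑ φ(i, m) S^i T^m`, where `S = ∑ x_a` and
`T = ∑ x_a ^ k` are power sums. -/
noncomputable def psumSeries (σ : Type*) [Fintype σ] (k N : ℕ) (φ : ℕ → ℕ → R) :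
    MvPolynomial σ R :=
  ∑ i ∈ range N, ∑ m ∈ range N, C (φ i m) * (psum σ R 1 ^ i * psum σ R k ^ m)

/-- Prepending a `0` to a sequence. -/
def shift {M : Type*} [Zero M] (f : ℕ → M) : ℕ → M
  | 0 => 0
  | n + 1 => f n

variable {k N : ℕ}

lemma coeff_psumSeries (φ : ℕ → ℕ → R) (c : σ →₀ ℕ) :
    coeff c (psumSeries σ k N φ) =
      ∑ i ∈ range N, ∑ m ∈ range N, φ i m * coeff c (psum σ R 1 ^ i * psum σ R k ^ m) := by
  simp [psumSeries, coeff_sum, coeff_C_mul]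

lemma coeff_psum_one_mul_psumSeries (φ : ℕ → ℕ → R) {c : σ →₀ ℕ} (hc : c.degree < N) :
    coeff c (psum σ R 1 * psumSeries σ k N φ) = coeff c (psumSeries σ k N (shift φ)) := by
  have h : psum σ R 1 * psumSeries σ k N φ = ∑ i ∈ range N, ∑ m ∈ range N,
      C (φ i m) * (psum σ R 1 ^ (i + 1) * psum σ R k ^ m) := by
    simp only [psumSeries, mul_sum]
    refine sum_congr rfl fun i _ => sum_congr rfl fun m _ => by ring
  rw [h, coeff_psumSeries]
  simp only [coeff_sum, coeff_C_mul]
  obtain ⟨M, rfl⟩ : ∃ M, N = M + 1 := ⟨N - 1, by omega⟩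
  refine (sum_range_succ _ _).trans (Eq.trans ?_ (sum_range_succ' _ _).symm)
  congr 1
  rw [sum_eq_zero, sum_eq_zero]
  · intro m _; simp [shift]
  · intro m _
    rw [coeff_psum_pow_mul_eq_zero, mul_zero]
    omega

lemma coeff_psum_mul_psumSeries (hk : 1 ≤ k) (φ : ℕ → ℕ → R) {c : σ →₀ ℕ} (hc : c.degree < N) :
    coeff c (psum σ R k * psumSeries σ k N φ) =
      coeff c (psumSeries σ k N fun i => shift (φ i)) := by
  have h : psum σ R k * psumSeries σ k N φ = ∑ i ∈ range N, ∑ m ∈ range N,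
      C (φ i m) * (psum σ R 1 ^ i * psum σ R k ^ (m + 1)) := by
    simp only [psumSeries, mul_sum]
    refine sum_congr rfl fun i _ => sum_congr rfl fun m _ => by ring
  rw [h, coeff_psumSeries]
  simp only [coeff_sum, coeff_C_mul]
  refine sum_congr rfl fun i _ => ?_
  obtain ⟨M, rfl⟩ : ∃ M, N = M + 1 := ⟨N - 1, by omega⟩
  rw [sum_range_succ, sum_range_succ' _ M]
  congr 1
  rw [coeff_psum_pow_mul_eq_zero, mul_zero]
  · simp [shift]
  · nlinarith

/-- The run enumerators are determined by `runSum_eq`, which the two series on the right satisfy as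
soon as their coefficients satisfy the two recurrences. Here `r i` stands for `R ^ i` and `r' i` for
`R ^ i / (1 - (1 - z) y ^ 2)`, where `R = (1 - (1 - z) y) / (1 - (1 - z) y ^ 2)`. -/
lemma runSum_eq_coeff_psumSeries (hk : 1 ≤ k) {z : R} {r r' : ℕ → ℕ → R}
    (h0 : r 0 = fun m => if m = 0 then 1 else 0)
    (h1 : ∀ i m, r (i + 1) m = r' i m - (1 - z) * shift (r' i) m)
    (h2 : ∀ i m, r' i m - (1 - z) * shift (shift (r' i)) m = r i m)
    {c : σ →₀ ℕ} (hc : ∀ a, c a ≤ k) (hN : c.degree < N) :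
    runSum k z false c = coeff c (psumSeries σ k N fun i => r (i + 1)) ∧
      runSum k z true c = coeff c (psumSeries σ k N r') := by
  set F : Bool → MvPolynomial σ R := fun b =>
    if b then psumSeries σ k N r' else psumSeries σ k N fun i => r (i + 1) with hF
  suffices h : ∀ b, runSum k z b c = coeff c (F b) from ⟨h false, h true⟩
  -- the equations that `F` satisfies in degrees less than `N`
  have e1 : ∀ c : σ →₀ ℕ, c.degree < N → coeff c (F false) =
      coeff c (F true) - (1 - z) * coeff c (psum σ R k * F true) := by
    intro c hN
    simp only [hF, if_true, Bool.false_eq_true, if_false]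
    rw [coeff_psum_mul_psumSeries hk _ hN]
    simp only [coeff_psumSeries, mul_sum, ← sum_sub_distrib]
    refine sum_congr rfl fun i _ => sum_congr rfl fun m _ => ?_
    rw [h1]; ring
  have e2 : ∀ c : σ →₀ ℕ, c.degree < N → coeff c (F true) =
      coeff c 1 + coeff c (psum σ R 1 * F false) +
        (coeff c (psum σ R k * F true) - coeff c (psum σ R k * F false)) := by
    intro c hN
    have hone : coeff c (1 : MvPolynomial σ R) = coeff c (psumSeries σ k N
        fun i m => if i = 0 ∧ m = 0 then 1 else 0) := by
      congr 1
      rw [psumSeries, sum_eq_single_of_mem 0 (by simp; omega),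
        sum_eq_single_of_mem 0 (by simp; omega)]
      · simp
      · intro m _ hm; simp [hm]
      · intro i _ hi; simp [hi]
    simp only [hF, if_true, Bool.false_eq_true, if_false]
    rw [coeff_psum_mul_psumSeries hk _ hN, coeff_psum_mul_psumSeries hk _ hN,
      coeff_psum_one_mul_psumSeries _ hN, hone]
    simp only [coeff_psumSeries, ← sum_sub_distrib, ← sum_add_distrib]
    refine sum_congr rfl fun i _ => sum_congr rfl fun m _ => ?_
    rw [← sub_mul, ← add_mul, ← add_mul]
    congr 1
    have hr : ((if i = 0 ∧ m = 0 then 1 else 0 : R) + shift (fun i => r (i + 1)) i m) = r i m := by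
      rcases i with _ | i
      · simp [shift, h0]
      · simp [shift]
    rw [hr, ← h2]
    rcases m with _ | m
    · simp [shift]
    · simp only [shift, h1]; ring
  clear_value F
  clear h0 h1 h2
  induction hd : c.degree using Nat.strong_induction_on generalizing c with
  | _ d ih =>
  subst hd
  have ih' : ∀ b a m, 1 ≤ m → Finsupp.single a m ≤ c →
      runSum k z b (c - .single a m) = coeff (c - .single a m) (F b) := by
    intro b a m hm ha
    have hlt : (c - .single a m).degree < c.degree := by
      have := congrArg Finsupp.degree (tsub_add_cancel_of_le ha)
      rw [map_add, Finsupp.degree_single] at this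
      omega
    refine ih _ hlt (fun x => ?_) (hlt.trans hN) rfl b
    exact (Nat.sub_le _ _).trans (hc x)
  intro b
  have main : coeff c (F b) = coeff c 1 + coeff c (psum σ R 1 * F false) +
      ((if b then 1 else z) * coeff c (psum σ R k * F true) -
        coeff c (psum σ R k * F false)) := by
    cases b
    · rw [e1 c hN, e2 c hN]; simp; ring
    · rw [e2 c hN]; simp
  rw [main]
  rcases eq_or_ne c 0 with rfl | hc0
  · have : ∀ a : σ, ¬ Finsupp.single a k ≤ 0 := fun a => by
      simp; omega
    simp [runSum_zero, coeff_psum_mul, this, -psum_one]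
  · rw [runSum_eq hk z b hc hc0, coeff_one, if_neg hc0.symm, zero_add, coeff_psum_mul,
      coeff_psum_mul, coeff_psum_mul, mul_sum, ← sum_sub_distrib]
    congr 1
    · refine sum_congr rfl fun a _ => ?_
      split_ifs with h
      · exact ih' _ _ _ le_rfl h
      · rfl
    · refine sum_congr rfl fun a _ => ?_
      split_ifs with h hb
      all_goals first
        | rw [ih' _ _ _ hk h, ih' _ _ _ hk h]
        | simp

lemma coeff_psum_one_pow_indicator (hk : 1 ≤ k) (B : Finset σ) :
    coeff (Finsupp.indicator B fun _ _ => k) (psum σ R 1 ^ (k * #B)) * (k.factorial : R) ^ #B =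
      (k * #B).factorial := by
  have hs : (Finsupp.indicator B fun _ _ => k).support = B := by
    ext a; simp [Finsupp.indicator_apply]; intro _; omega
  have hsum : (Finsupp.indicator B fun _ _ => k).sum (fun _ m => m) = k * #B := by
    rw [Finsupp.sum, hs, sum_congr rfl (g := fun _ => k)]
    · simp [mul_comm]
    · intro a ha; simp [Finsupp.indicator_apply, ha]
  rw [psum_one, coeff_sum_X_pow_of_fintype, if_pos hsum, Finsupp.multinomial_eq, hs]
  have := Nat.multinomial_spec B (Finsupp.indicator B fun _ _ => k)
  rw [prod_congr rfl (g := fun _ => k.factorial), prod_const, sum_congr rfl (g := fun _ => k),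
    sum_const, smul_eq_mul, mul_comm (#B) k] at this
  · rw [← this]; push_cast; ring
  · intro a ha; simp [Finsupp.indicator_apply, ha]
  · intro a ha; simp [Finsupp.indicator_apply, ha]

/-- The `m` factors `T` take up `m` of the letters, in any order. -/
lemma coeff_psum_pow_mul_indicator (hk : 1 ≤ k) (B : Finset σ) {j m : ℕ} (h : j + m = #B) :
    coeff (Finsupp.indicator B fun _ _ => k) (psum σ R 1 ^ (k * j) * psum σ R k ^ m) *
      ((j.factorial : R) * (k.factorial : R) ^ j) = (#B).factorial * (k * j).factorial := by
  induction m generalizing B with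
  | zero =>
    rw [add_zero] at h
    subst h
    rw [← coeff_psum_one_pow_indicator (R := R) hk B]
    simp; ring
  | succ m ih =>
    rw [pow_succ', mul_left_comm (psum σ R 1 ^ _), coeff_psum_mul, sum_mul]
    have hstep : ∀ a, (if Finsupp.single a k ≤ Finsupp.indicator B (fun _ _ => k) then
        coeff (Finsupp.indicator B (fun _ _ => k) - .single a k)
          (psum σ R 1 ^ (k * j) * psum σ R k ^ m) else 0) *
          ((j.factorial : R) * (k.factorial : R) ^ j) =
        if a ∈ B then ((#B - 1).factorial * (k * j).factorial : R) else 0 := by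
      intro a
      by_cases ha : a ∈ B
      · have he : Finsupp.indicator B (fun _ _ => k) - .single a k =
            Finsupp.indicator (B.erase a) fun _ _ => k := by
          ext x
          by_cases hx : x = a
          · subst hx; simp [Finsupp.indicator_apply, ha]
          · simp [Finsupp.indicator_apply, hx]
        rw [if_pos, he, ih (B.erase a) (by rw [card_erase_of_mem ha]; omega), if_pos ha,
          card_erase_of_mem ha]
        simp [Finsupp.single_le_iff, Finsupp.indicator_apply, ha]
      · rw [if_neg, if_neg ha, zero_mul]
        simp [Finsupp.single_le_iff, Finsupp.indicator_apply, ha]; omega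
    rw [sum_congr rfl fun a _ => hstep a, sum_ite_mem, univ_inter, sum_const, nsmul_eq_mul,
      ← mul_assoc, ← Nat.cast_mul, Nat.mul_factorial_pred (by omega)]

end TruncatedSeries

/-! ### Diagrams: components, and labellings as words -/

namespace LinearChordDiagram

section Components

variable {k n : ℕ} (D : LinearChordDiagram k n)

/-- A short chord of `D` occupies the `k` vertices from `p` on. -/
def IsShortAt (p : ℕ) : Prop := ∃ s ∈ D.chords, s.map Fin.valEmbedding = Ico p (p + k)

variable {D}

lemma mem_iff_of_map_eq {s : Finset (Fin (k * n))} {p : ℕ}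
    (h : s.map Fin.valEmbedding = Ico p (p + k)) (i : Fin (k * n)) :
    i ∈ s ↔ p ≤ i ∧ (i : ℕ) < p + k := by
  rw [← mem_Ico, ← h]
  simp [Fin.val_inj]

lemma exists_mem_of_map_eq {s : Finset (Fin (k * n))} {p x : ℕ}
    (h : s.map Fin.valEmbedding = Ico p (p + k)) (hx : p ≤ x) (hx' : x < p + k) :
    ∃ i ∈ s, (i : ℕ) = x := by
  have : x ∈ s.map Fin.valEmbedding := by rw [h, mem_Ico]; exact ⟨hx, hx'⟩
  simpa using this

lemma eq_of_map_eq {s t : Finset (Fin (k * n))} (hs : s ∈ D.chords) (ht : t ∈ D.chords) {a b : ℕ}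
    (ha : s.map Fin.valEmbedding = Ico a (a + k)) (hb : t.map Fin.valEmbedding = Ico b (b + k))
    (hab : a < b + k) (hba : b < a + k) : s = t := by
  obtain ⟨i, hi, hix⟩ := exists_mem_of_map_eq (x := max a b) ha (by omega) (by omega)
  exact D.toPartition.eq_of_mem_parts hs ht hi ((mem_iff_of_map_eq hb i).2 (by omega))

/-- The first vertex of a short chord. -/
noncomputable def ShortChord.start (s : D.ShortChord) : ℕ := s.2.2.choose

lemma ShortChord.map_eq (s : D.ShortChord) :
    s.1.map Fin.valEmbedding = Ico s.start (s.start + k) := s.2.2.choose_spec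

lemma ShortChord.start_eq (hk : 1 ≤ k) (s : D.ShortChord) {p : ℕ}
    (h : s.1.map Fin.valEmbedding = Ico p (p + k)) : s.start = p := by
  have h1 := s.map_eq
  rw [h] at h1
  have h2 : p ∈ Ico s.start (s.start + k) := h1 ▸ mem_Ico.2 ⟨le_rfl, by omega⟩
  have h3 : s.start ∈ Ico p (p + k) := h1.symm ▸ mem_Ico.2 ⟨le_rfl, by omega⟩
  rw [mem_Ico] at h2 h3
  omega

lemma ShortChord.eq_of_start_lt (s t : D.ShortChord) (h : s.start < t.start + k)
    (h' : t.start < s.start + k) : s = t :=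
  Subtype.ext (eq_of_map_eq s.2.1 t.2.1 s.map_eq t.map_eq h h')

lemma ShortChord.isShortAt_start (s : D.ShortChord) : D.IsShortAt s.start :=
  ⟨s.1, s.2.1, s.map_eq⟩

lemma IsShortAt.exists_start_eq (hk : 1 ≤ k) {p : ℕ} (h : D.IsShortAt p) :
    ∃ s : D.ShortChord, s.start = p := by
  obtain ⟨s, hs, hp⟩ := h
  exact ⟨⟨s, hs, p, hp⟩, ShortChord.start_eq hk _ hp⟩

lemma IsShortAt.add_le (hk : 1 ≤ k) {p : ℕ} (h : D.IsShortAt p) : p + k ≤ k * n := by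
  obtain ⟨s, -, hp⟩ := h
  obtain ⟨i, -, hi⟩ := exists_mem_of_map_eq (x := p + k - 1) hp (by omega) (by omega)
  omega

lemma shortChordGraph_adj_iff (hk : 1 ≤ k) (s t : D.ShortChord) :
    D.shortChordGraph.Adj s t ↔ t.start = s.start + k ∨ s.start = t.start + k := by
  constructor
  · rintro ⟨hst, i, hi, j, hj, hij⟩
    rw [mem_iff_of_map_eq s.map_eq] at hi
    rw [mem_iff_of_map_eq t.map_eq] at hj
    by_contra! h
    exact hst (s.eq_of_start_lt t (by omega) (by omega))
  · rintro (h | h)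
    · refine ⟨by rintro rfl; omega, ?_⟩
      obtain ⟨i, hi, hi'⟩ := exists_mem_of_map_eq (x := s.start + k - 1) s.map_eq
        (by omega) (by omega)
      obtain ⟨j, hj, hj'⟩ := exists_mem_of_map_eq (x := t.start) t.map_eq le_rfl (by omega)
      exact ⟨i, hi, j, hj, by omega⟩
    · refine ⟨by rintro rfl; omega, ?_⟩
      obtain ⟨i, hi, hi'⟩ := exists_mem_of_map_eq (x := t.start + k - 1) t.map_eq
        (by omega) (by omega)
      obtain ⟨j, hj, hj'⟩ := exists_mem_of_map_eq (x := s.start) s.map_eq le_rfl (by omega)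
      exact ⟨j, hj, i, hi, by omega⟩

/-- A short chord not preceded by a short chord is the leftmost one of its component. -/
lemma start_le_of_reachable (hk : 1 ≤ k) {s t : D.ShortChord}
    (hs : ¬(k ≤ s.start ∧ D.IsShortAt (s.start - k))) (h : D.shortChordGraph.Reachable s t) :
    s.start ≤ t.start := by
  have key : ∀ u v : D.ShortChord, D.shortChordGraph.Adj u v → s.start ≤ u.start →
      s.start ≤ v.start := by
    intro u v huv hu
    rcases (shortChordGraph_adj_iff hk u v).1 huv with h | h
    · omega
    · by_contra! hlt
      -- `u` overlaps `s`, so `u = s`, and `v` precedes it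
      have hus : s = u := s.eq_of_start_lt u (by omega) (by omega)
      subst hus
      refine hs ⟨by omega, ?_⟩
      rw [h, Nat.add_sub_cancel]
      exact v.isShortAt_start
  obtain ⟨w⟩ := h
  suffices ∀ u v : D.ShortChord, D.shortChordGraph.Walk u v → s.start ≤ u.start →
      s.start ≤ v.start from this s t w le_rfl
  intro u v w hu
  induction w with
  | nil => exact hu
  | cons huv _ ih => exact ih (key _ _ huv hu)

/-- Every component is counted at its leftmost short chord. -/
lemma numComponents_eq_card (hk : 1 ≤ k) :
    D.numComponents =
      #{p ∈ range (k * n) | D.IsShortAt p ∧ ¬(k ≤ p ∧ D.IsShortAt (p - k))} := by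
  rw [numComponents]
  set P : ℕ → Prop := fun p => D.IsShortAt p ∧ ¬(k ≤ p ∧ D.IsShortAt (p - k)) with hP
  set A : Finset ℕ := {p ∈ range (k * n) | P p}
  have hA : ∀ p, p ∈ A ↔ P p := fun p => by
    rw [mem_filter, mem_range, and_iff_right_iff_imp]
    intro h
    have := h.1.add_le hk
    omega
  have hch : ∀ p : A, ∃ s : D.ShortChord, s.start = p := fun p =>
    ((hA p).1 p.2).1.exists_start_eq hk
  choose f hf using hch
  rw [← Fintype.card_coe A, ← Nat.card_eq_fintype_card]
  refine (Nat.card_congr (Equiv.ofBijective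
    (fun p => D.shortChordGraph.connectedComponentMk (f p)) ⟨?_, ?_⟩)).symm
  · intro p p' h
    have hr : D.shortChordGraph.Reachable (f p) (f p') := SimpleGraph.ConnectedComponent.exact h
    have h1 := start_le_of_reachable hk (by rw [hf]; exact ((hA p).1 p.2).2) hr
    have h2 := start_le_of_reachable hk (by rw [hf]; exact ((hA p').1 p'.2).2) hr.symm
    rw [hf, hf] at h1 h2
    exact Subtype.ext (le_antisymm h1 h2)
  · intro C
    induction C using SimpleGraph.ConnectedComponent.ind with
    | _ s =>
    induction hd : s.start using Nat.strong_induction_on generalizing s with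
    | _ d ih =>
    by_cases h : k ≤ s.start ∧ D.IsShortAt (s.start - k)
    · obtain ⟨t, ht⟩ := h.2.exists_start_eq hk
      obtain ⟨p, hp⟩ := ih t.start (by omega) t rfl
      refine ⟨p, hp.trans (SimpleGraph.ConnectedComponent.sound (SimpleGraph.Adj.reachable ?_))⟩
      exact (shortChordGraph_adj_iff hk t s).2 (by omega)
    · refine ⟨⟨s.start, (hA _).2 ⟨s.isShortAt_start, h⟩⟩, ?_⟩
      dsimp only
      congr 1
      exact ShortChord.eq_of_start_lt _ _ (by rw [hf]; dsimp only; omega)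
        (by rw [hf]; dsimp only; omega)

end Components

section Labellings

variable {k n : ℕ}

lemma length_of_mem_words {σ : Type*} [Fintype σ] {c : σ →₀ ℕ} {l : List σ} (h : l ∈ words c) :
    l.length = ∑ a, c a := by
  rw [← sum_congr rfl fun a _ => mem_words.1 h a]
  simpa using (Multiset.sum_count_eq_card (s := univ) (m := (l : Multiset σ)) (by simp)).symm

lemma count_ofFn {α : Type*} {N : ℕ} (f : Fin N → α) (a : α) :
    (List.ofFn f).count a = #{i | f i = a} := by
  induction N with
  | zero => simp
  | succ N ih =>
    rw [Fin.card_filter_univ_succ', List.ofFn_succ, List.count_cons, ih, add_comm]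
    simp

lemma isBlockAt_ofFn {α : Type*} {N : ℕ} (hk : 1 ≤ k) (f : Fin N → α) (p : ℕ) :
    IsBlockAt k (List.ofFn f) p ↔
      p + k ≤ N ∧ ∃ a, ∀ i : Fin N, p ≤ i → (i : ℕ) < p + k → f i = a := by
  simp only [IsBlockAt, List.prefix_iff_getElem]
  simp only [List.length_replicate, List.length_drop, List.length_ofFn, List.getElem_replicate,
    List.getElem_drop, List.getElem_ofFn]
  constructor
  · rintro ⟨a, h, ha⟩
    refine ⟨by omega, a, fun i hi hi' => ?_⟩
    rw [ha (i - p) (by omega)]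
    congr 1
    ext
    simp; omega
  · rintro ⟨h, a, ha⟩
    exact ⟨a, by omega, fun i hi => (ha _ (by simp) (by simpa using hi)).symm⟩

variable (D : LinearChordDiagram k n)

lemma part_mem_chords (i : Fin (k * n)) : D.toPartition.part i ∈ D.chords :=
  D.toPartition.part_mem.2 (mem_univ i)

lemma card_chords (hk : 1 ≤ k) : #D.chords = n := by
  have h := D.toPartition.sum_card_parts
  rw [sum_congr rfl D.card_chord, sum_const, card_univ, Fintype.card_fin, smul_eq_mul] at h
  exact Nat.eq_of_mul_eq_mul_right hk (h.trans (mul_comm k n))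

/-- The word spelled by a labelling `e` of the chords: its letter at a vertex is the label of the
chord through that vertex. -/
noncomputable def labelWord (e : D.chords ≃ Fin n) (i : Fin (k * n)) : Fin n :=
  e ⟨D.toPartition.part i, D.part_mem_chords i⟩

variable {D}

lemma labelWord_eq_iff (e : D.chords ≃ Fin n) (i : Fin (k * n)) (a : Fin n) :
    D.labelWord e i = a ↔ i ∈ (e.symm a).1 := by
  rw [labelWord, ← Equiv.eq_symm_apply, Subtype.ext_iff]
  exact D.toPartition.part_eq_iff_mem (e.symm a).2

lemma isBlockAt_labelWord (hk : 1 ≤ k) (e : D.chords ≃ Fin n) (p : ℕ) :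
    IsBlockAt k (List.ofFn (D.labelWord e)) p ↔ D.IsShortAt p := by
  rw [isBlockAt_ofFn hk]
  simp only [labelWord_eq_iff]
  constructor
  · rintro ⟨hp, a, ha⟩
    refine ⟨(e.symm a).1, (e.symm a).2, (eq_of_subset_of_card_le ?_ ?_).symm⟩
    · intro x hx
      rw [mem_Ico] at hx
      exact mem_map.2 ⟨⟨x, by omega⟩, ha _ hx.1 hx.2, rfl⟩
    · rw [card_map, D.card_chord _ (e.symm a).2, Nat.card_Ico]
      omega
  · intro h
    refine ⟨h.add_le hk, ?_⟩
    obtain ⟨s, hs, hp⟩ := h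
    refine ⟨e ⟨s, hs⟩, fun i hi hi' => ?_⟩
    rw [Equiv.symm_apply_apply]
    exact (mem_iff_of_map_eq hp i).2 ⟨hi, hi'⟩

lemma numRuns_labelWord (hk : 1 ≤ k) (e : D.chords ≃ Fin n) :
    numRuns k false (List.ofFn (D.labelWord e)) = D.numComponents := by
  rw [numComponents_eq_card hk, numRuns, List.length_ofFn]
  simp [isBlockAt_labelWord hk]

lemma toPartition_injective :
    Function.Injective (toPartition : LinearChordDiagram k n → _) := by
  rintro ⟨P, _⟩ ⟨Q, _⟩ h
  congr

noncomputable instance : Fintype (LinearChordDiagram k n) :=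
  Fintype.ofInjective _ toPartition_injective

lemma labelWord_injective :
    Function.Injective (fun x : Σ D : LinearChordDiagram k n, D.chords ≃ Fin n =>
      x.1.labelWord x.2) := by
  rintro ⟨D, e⟩ ⟨D', e'⟩ h
  have hfib : ∀ a, (e.symm a).1 = (e'.symm a).1 := fun a => by
    ext i
    rw [← labelWord_eq_iff, ← labelWord_eq_iff]
    exact Iff.of_eq (congrArg (· = a) (congrFun h i))
  have hD : D = D' := by
    apply toPartition_injective
    ext s
    constructor
    · intro hs
      rw [← show (e.symm (e ⟨s, hs⟩)).1 = s by simp, hfib]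
      exact (e'.symm _).2
    · intro hs
      rw [← show (e'.symm (e' ⟨s, hs⟩)).1 = s by simp, ← hfib]
      exact (e.symm _).2
  subst hD
  have he : e.symm = e'.symm := Equiv.ext fun a => Subtype.ext (hfib a)
  rw [← e.symm_symm, he, e'.symm_symm]

/-- Every function whose fibres have `k` elements spells a labelled diagram, whose chords are these
fibres. -/
lemma exists_labelWord_eq (hk : 1 ≤ k) (f : Fin (k * n) → Fin n) (hf : ∀ a, #{i | f i = a} = k) :
    ∃ (D : LinearChordDiagram k n) (e : D.chords ≃ Fin n), D.labelWord e = f := by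
  set fib : Fin n → Finset (Fin (k * n)) := fun a => {i | f i = a} with hfib
  have hne : ∀ a, (fib a).Nonempty := fun a => by
    rw [← card_pos, hf a]; omega
  have hinj : Function.Injective fib := fun a b hab => by
    obtain ⟨i, hi⟩ := hne a
    have hi' := hab ▸ hi
    rw [mem_filter] at hi hi'
    exact hi.2.symm.trans hi'.2
  let P : Finpartition (univ : Finset (Fin (k * n))) :=
    Finpartition.ofExistsUnique (univ.image fib) (fun _ _ => subset_univ _)
      (fun i _ => ⟨fib (f i), by simp [hfib], by
        rintro _ ⟨h1, h2⟩
        obtain ⟨a, -, rfl⟩ := mem_image.1 h1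
        rw [(mem_filter.1 h2).2]⟩)
      (fun h => by
        obtain ⟨a, -, ha⟩ := mem_image.1 h
        exact (hne a).ne_empty ha)
  let D : LinearChordDiagram k n := ⟨P, fun s hs => by
    obtain ⟨a, -, rfl⟩ := mem_image.1 hs
    exact hf a⟩
  have hmem : ∀ a, fib a ∈ D.chords := fun a => mem_image_of_mem _ (mem_univ a)
  let e : Fin n ≃ D.chords := Equiv.ofBijective (fun a => ⟨fib a, hmem a⟩)
    ⟨fun a b hab => hinj (congrArg Subtype.val hab), fun s => by
      obtain ⟨a, -, ha⟩ := mem_image.1 s.2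
      exact ⟨a, Subtype.ext ha⟩⟩
  refine ⟨D, e.symm, funext fun i => (labelWord_eq_iff _ _ _).2 ?_⟩
  change i ∈ fib (f i)
  simp [hfib]

lemma exists_ofFn_eq {α : Type*} {N : ℕ} {l : List α} (h : l.length = N) :
    ∃ f : Fin N → α, List.ofFn f = l := by
  subst h
  exact ⟨l.get, List.ofFn_get l⟩

/-- The words in which each of `n` letters occurs `k` times enumerate the diagrams with labelled
chords, so that each diagram occurs `n!` times. -/
lemma runSum_eq_factorial_mul {R : Type*} [CommRing R] (hk : 1 ≤ k) (z : R) {c : Fin n →₀ ℕ}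
    (hc : ∀ a, c a = k) :
    runSum k z false c = n.factorial * ∑ D : LinearChordDiagram k n, z ^ D.numComponents := by
  have hcard : ∀ D : LinearChordDiagram k n, Fintype.card (D.chords ≃ Fin n) = n.factorial := by
    intro D
    have h : Fintype.card D.chords = n := (Fintype.card_coe _).trans (D.card_chords hk)
    rw [Fintype.card_equiv (Fintype.equivFinOfCardEq h), h]
  calc runSum k z false c
      = ∑ x : Σ D : LinearChordDiagram k n, D.chords ≃ Fin n, z ^ x.1.numComponents := by
        refine (sum_bij (fun x _ => List.ofFn (x.1.labelWord x.2)) ?_ ?_ ?_ ?_).symm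
        · rintro ⟨D, e⟩ -
          refine mem_words.2 fun a => ?_
          rw [count_ofFn, hc]
          refine Eq.trans ?_ (D.card_chord _ (e.symm a).2)
          congr 1
          ext i
          simp [labelWord_eq_iff]
        · intro x _ y _ hxy
          exact labelWord_injective (List.ofFn_injective hxy)
        · intro l hl
          have hlen : l.length = k * n := by
            rw [length_of_mem_words hl]
            simp [hc, mul_comm]
          obtain ⟨f, rfl⟩ := exists_ofFn_eq hlen
          obtain ⟨D, e, rfl⟩ := exists_labelWord_eq hk f fun a => by
            have h := mem_words.1 hl a
            rw [count_ofFn, hc] at h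
            convert h
          exact ⟨⟨D, e⟩, mem_univ _, rfl⟩
        · rintro ⟨D, e⟩ -
          rw [numRuns_labelWord hk]
    _ = _ := by
        rw [Fintype.sum_sigma, mul_sum]
        refine sum_congr rfl fun D _ => ?_
        simp [hcard]

end Labellings

end LinearChordDiagram

/-! ### Coefficients of powers of `y` -/

section Rows

/-- The coefficient of `y ^ m`, as a power series in `z`. -/
noncomputable def row (m : ℕ) : MvPowerSeries (Fin 2) ℚ →ₗ[ℚ] PowerSeries ℚ where
  toFun f := PowerSeries.mk fun q => MvPowerSeries.coeff (Finsupp.single 0 m + Finsupp.single 1 q) f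
  map_add' f g := by ext; simp
  map_smul' a f := by ext; simp

lemma coeff_row (m q : ℕ) (f : MvPowerSeries (Fin 2) ℚ) :
    PowerSeries.coeff q (row m f) =
      MvPowerSeries.coeff (Finsupp.single 0 m + Finsupp.single 1 q) f := by
  simp [row]

lemma row_one (m : ℕ) : row m 1 = if m = 0 then 1 else 0 := by
  ext q
  rw [coeff_row, MvPowerSeries.coeff_one]
  have h : (Finsupp.single 0 m + Finsupp.single 1 q : Fin 2 →₀ ℕ) = 0 ↔ m = 0 ∧ q = 0 := by
    simp
  rw [if_congr h rfl rfl]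
  split_ifs with h1 h2 h2 <;> simp_all [PowerSeries.coeff_one]

lemma row_yVar_mul (m : ℕ) (f : MvPowerSeries (Fin 2) ℚ) :
    row m (yVar * f) = shift (fun m => row m f) m := by
  ext q
  rw [coeff_row, yVar, MvPowerSeries.X, MvPowerSeries.coeff_monomial_mul]
  rcases m with _ | m
  · simp [shift, Finsupp.single_le_iff]
  · have h : (Finsupp.single 0 (m + 1) + Finsupp.single 1 q : Fin 2 →₀ ℕ) =
        Finsupp.single 0 1 + (Finsupp.single 0 m + Finsupp.single 1 q) := by
      rw [Finsupp.single_add]; abel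
    rw [h, if_pos le_self_add, one_mul, add_tsub_cancel_left]
    simp only [shift, coeff_row]

lemma row_zVar_mul (m : ℕ) (f : MvPowerSeries (Fin 2) ℚ) :
    row m (zVar * f) = PowerSeries.X * row m f := by
  ext q
  rw [coeff_row, zVar, MvPowerSeries.X, MvPowerSeries.coeff_monomial_mul]
  rcases q with _ | q
  · simp [Finsupp.single_le_iff]
  · rw [if_pos (by simp [Finsupp.single_le_iff]), one_mul, PowerSeries.coeff_succ_X_mul, coeff_row]
    congr 2
    rw [Finsupp.single_add, ← add_assoc, add_tsub_cancel_right]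

lemma row_yVar_mul_one_sub_zVar_mul (m : ℕ) (f : MvPowerSeries (Fin 2) ℚ) :
    row m (yVar * ((1 - zVar) * f)) = (1 - PowerSeries.X) * shift (fun m => row m f) m := by
  rw [row_yVar_mul]
  rcases m with _ | m
  · simp [shift]
  · simp only [shift]
    rw [sub_mul, one_mul, map_sub, row_zVar_mul]
    ring

lemma row_yVar_pow_mul {j m : ℕ} (h : j ≤ m) (f : MvPowerSeries (Fin 2) ℚ) :
    row m (yVar ^ j * f) = row (m - j) f := by
  induction j generalizing m with
  | zero => simp
  | succ j ih =>
    obtain ⟨m, rfl⟩ : ∃ r, m = r + 1 := ⟨m - 1, by omega⟩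
    rw [pow_succ', mul_assoc, row_yVar_mul]
    simp only [shift]
    rw [ih (by omega), Nat.add_sub_add_right]

lemma coeff_yVar_pow_mul_of_lt {d : Fin 2 →₀ ℕ} {j : ℕ} (h : d 0 < j)
    (f : MvPowerSeries (Fin 2) ℚ) : MvPowerSeries.coeff d (yVar ^ j * f) = 0 := by
  rw [yVar, MvPowerSeries.X_pow_eq, MvPowerSeries.coeff_monomial_mul, if_neg]
  rw [Finsupp.single_le_iff]
  omega

end Rows

/-! ### Extracting the coefficients -/

section Conclusion

/-- The denominator `1 - y²(1 - z)`, inverted. -/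
noncomputable def invDenom : MvPowerSeries (Fin 2) ℚ := (1 - yVar ^ 2 * (1 - zVar))⁻¹

/-- The series `R(y) = (1 - y(1 - z)) / (1 - y²(1 - z))`. -/
noncomputable def ratioSeries : MvPowerSeries (Fin 2) ℚ := (1 - yVar * (1 - zVar)) * invDenom

lemma denom_mul_invDenom : (1 - yVar ^ 2 * (1 - zVar)) * invDenom = 1 :=
  MvPowerSeries.mul_inv_cancel _ (by simp [yVar])

lemma componentTerm_eq (k j : ℕ) :
    componentTerm k j =
      (((k * j).factorial : ℚ) / ((j.factorial : ℚ) * (k.factorial : ℚ) ^ j)) •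
        (yVar ^ j * ratioSeries ^ (k * j + 1)) := by
  rw [componentTerm, MvPowerSeries.smul_eq_C_mul, mul_assoc]
  rfl

variable {k n : ℕ}

lemma factorial_mul_sum_X_pow_numComponents (hk : 1 ≤ k) :
    (n.factorial : PowerSeries ℚ) *
        ∑ D : LinearChordDiagram k n, (PowerSeries.X : PowerSeries ℚ) ^ D.numComponents =
      ∑ j ∈ range (n + 1), row (n - j) (ratioSeries ^ (k * j + 1)) *
        MvPolynomial.coeff (Finsupp.indicator (univ : Finset (Fin n)) fun _ _ => k)
          (MvPolynomial.psum (Fin n) (PowerSeries ℚ) 1 ^ (k * j) *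
            MvPolynomial.psum (Fin n) (PowerSeries ℚ) k ^ (n - j)) := by
  set c : Fin n →₀ ℕ := Finsupp.indicator univ fun _ _ => k with hc
  have hca : ∀ a, c a = k := fun a => by simp [hc, Finsupp.indicator_apply]
  have hdeg : c.degree = k * n := by
    simp [Finsupp.degree_eq_sum, hca, mul_comm]
  have key := (runSum_eq_coeff_psumSeries (σ := Fin n) (N := k * n + 1) hk
    (z := (PowerSeries.X : PowerSeries ℚ))
    (r := fun i m => row m (ratioSeries ^ i)) (r' := fun i m => row m (ratioSeries ^ i * invDenom))
    (by simp [row_one])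
    (fun i m => by
      rw [← row_yVar_mul_one_sub_zVar_mul, ← map_sub]
      congr 1
      rw [pow_succ, ratioSeries]
      ring)
    (fun i m => by
      have hs : shift (fun m => row m (ratioSeries ^ i * invDenom)) =
          fun m => row m (yVar * (ratioSeries ^ i * invDenom)) :=
        funext fun m => (row_yVar_mul m _).symm
      rw [hs, ← row_yVar_mul_one_sub_zVar_mul, ← map_sub]
      congr 1
      linear_combination ratioSeries ^ i * denom_mul_invDenom)
    (c := c) (fun a => (hca a).le) (by omega)).1
  rw [← LinearChordDiagram.runSum_eq_factorial_mul hk _ hca, key, coeff_psumSeries, sum_comm,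
    ← sum_subset (range_mono (show n + 1 ≤ k * n + 1 by nlinarith)), ← sum_range_reflect]
  · refine sum_congr rfl fun j hj => ?_
    have hjn : j ≤ n := by simpa [Nat.lt_succ_iff] using hj
    rw [show n + 1 - 1 - j = n - j by omega]
    refine sum_eq_single_of_mem (k * j) (by simpa using by gcongr) fun i _ hi => ?_
    rw [coeff_psum_pow_mul_eq_zero, mul_zero]
    rw [hdeg]
    have : k * n = k * j + k * (n - j) := by rw [← mul_add]; congr 1; omega
    omega
  · intro m _ hm
    refine sum_eq_zero fun i _ => ?_
    rw [coeff_psum_pow_mul_eq_zero, mul_zero]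
    rw [hdeg]
    have : k * n < k * m := by
      apply Nat.mul_lt_mul_of_pos_left _ hk
      simpa using hm
    omega

/-- The coefficient of `y ^ n` in the series of the theorem enumerates the diagrams with `n` chords
by their number of components. -/
lemma sum_X_pow_numComponents (hk : 1 ≤ k) :
    ∑ D : LinearChordDiagram k n, (PowerSeries.X : PowerSeries ℚ) ^ D.numComponents =
      ∑ j ∈ range (n + 1),
        (((k * j).factorial : ℚ) / ((j.factorial : ℚ) * (k.factorial : ℚ) ^ j)) •
          row (n - j) (ratioSeries ^ (k * j + 1)) := by
  have : CharZero (PowerSeries ℚ) := algebraRat.charZero _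
  have hn : (n.factorial : PowerSeries ℚ) ≠ 0 := by
    exact_mod_cast n.factorial_ne_zero
  apply mul_left_cancel₀ hn
  rw [factorial_mul_sum_X_pow_numComponents hk, mul_sum]
  refine sum_congr rfl fun j hj => ?_
  have hjn : j ≤ n := by simpa [Nat.lt_succ_iff] using hj
  have h := coeff_psum_pow_mul_indicator (R := PowerSeries ℚ) hk (univ : Finset (Fin n))
    (j := j) (m := n - j) (by simp; omega)
  rw [card_univ, Fintype.card_fin] at h
  have hne : (j.factorial : PowerSeries ℚ) * (k.factorial : PowerSeries ℚ) ^ j ≠ 0 := by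
    exact_mod_cast (Nat.mul_pos j.factorial_pos (pow_pos k.factorial_pos j)).ne'
  have hq : PowerSeries.C (((k * j).factorial : ℚ) / ((j.factorial : ℚ) * (k.factorial : ℚ) ^ j)) *
      ((j.factorial : PowerSeries ℚ) * (k.factorial : PowerSeries ℚ) ^ j) =
      ((k * j).factorial : PowerSeries ℚ) := by
    have : ((j.factorial : PowerSeries ℚ) * (k.factorial : PowerSeries ℚ) ^ j) =
        PowerSeries.C ((j.factorial : ℚ) * (k.factorial : ℚ) ^ j) := by simp
    rw [this, ← map_mul, div_mul_cancel₀]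
    · simp
    · positivity
  apply mul_right_cancel₀ hne
  rw [PowerSeries.smul_eq_C_mul]
  linear_combination row (n - j) (ratioSeries ^ (k * j + 1)) * h -
    (n.factorial : PowerSeries ℚ) * row (n - j) (ratioSeries ^ (k * j + 1)) * hq

lemma coeff_sum_X_pow_numComponents (q : ℕ) :
    PowerSeries.coeff q
        (∑ D : LinearChordDiagram k n, (PowerSeries.X : PowerSeries ℚ) ^ D.numComponents) =
      componentCount k n q := by
  rw [map_sum, componentCount, Nat.card_eq_fintype_card, Fintype.card_subtype, card_filter,
    Nat.cast_sum]
  refine sum_congr rfl fun D _ => ?_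
  rw [PowerSeries.coeff_X_pow]
  simp [eq_comm]

end Conclusion

theorem theorem21 (k : ℕ) (hk : 1 ≤ k) :
    ∃ C : MvPowerSeries (Fin 2) ℚ,
      HasFormalSum (componentTerm k) C ∧
      ∀ n q : ℕ,
        MvPowerSeries.coeff (Finsupp.single 0 n + Finsupp.single 1 q) C =
          (componentCount k n q : ℚ) := by
  have hzero : ∀ (d : Fin 2 →₀ ℕ) (j : ℕ), d 0 < j →
      MvPowerSeries.coeff d (componentTerm k j) = 0 := fun d j h => by
    rw [componentTerm_eq, map_smul, coeff_yVar_pow_mul_of_lt h, smul_zero]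
  -- the term `j` is divisible by `y ^ j`, so the coefficient of `d` comes from the terms `j ≤ d 0`
  refine ⟨fun d => ∑ j ∈ range (d 0 + 1), MvPowerSeries.coeff d (componentTerm k j), ?_, ?_⟩
  · intro d
    have hsub : {j | MvPowerSeries.coeff d (componentTerm k j) ≠ 0} ⊆ (range (d 0 + 1) : Set ℕ) := by
      intro j hj
      rw [mem_coe, mem_range]
      by_contra hlt
      exact hj (hzero d j (by omega))
    refine ⟨(finite_toSet _).subset hsub, ?_⟩
    exact finsum_eq_sum_of_support_subset _ hsub
  · intro n q
    rw [← coeff_sum_X_pow_numComponents, sum_X_pow_numComponents hk, map_sum]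
    change ∑ j ∈ range ((Finsupp.single 0 n + Finsupp.single 1 q : Fin 2 →₀ ℕ) 0 + 1), _ = _
    have h0 : (Finsupp.single 0 n + Finsupp.single 1 q : Fin 2 →₀ ℕ) 0 = n := by simp
    rw [h0]
    refine sum_congr rfl fun j hj => ?_
    have hjn : j ≤ n := by simpa [Nat.lt_succ_iff] using hj
    rw [← coeff_row, componentTerm_eq, map_smul, row_yVar_pow_mul hjn]
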